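/- Let $K$ be a finite connected polygonal complex in $\mathbb{R}^2$, given by its polygons (simple, not necessarily convex), any two of which are disjoint or meet in one common vertex or one common edge. Let finitely many bounded polygonal regions (holes) and one unbounded polygonal region (the outside) be given such that: the polygons, the holes and the outside cover $\mathbb{R}^2$; each polygon of $K$ meets each hole, and the outside, in common vertices and edges only; the holes are pairwise disjoint and disjoint from the outside; a polygon of $K$ shares at most one edge with any hole; and no polygon of $K$ shares two adjacent edges with the outside. Call the polygons, the holes and the outside cells. The Euler transformation $\hat K$ of $K$ has as vertices the copies $\hat v_c$ of the vertices $v$ of each cell $c$, and three classes of polygons: (1) the copy $\hat f$ of each polygon $f$ of $K$; (2) for each edge $e=\{u,v\}$ of $K$, lying in the two cells $c,c'$, the 4-gon $\hat f_e$ with edges $\{\hat u_c,\hat v_c\}$, $\{\hat v_c,\hat v_{c'}\}$, $\{\hat u_{c'},\hat v_{c'}\}$, $\{\hat u_c,\hat u_{c'}\}$; (3) for each vertex $v$ of $K$, the polygon $\hat f_v$ whose edges are the $\{\hat v_c,\hat v_{c'}\}$ with $c\neq c'$ cells having a common edge at $v$. The Euler transformation with combinatorial changes is obtained by collapsing some edges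 of the copies $\hat f$ to points, so that each $\hat f$ keeps at least three edges: the end points of each collapsed edge are identified, and edges that acquire the same two distinct end points become one edge of the $1$-skeleton. The cells that are holes or the outside are left unchanged. Let $f$ be a polygon of $K$, and let $\hat v$ be a vertex of $\hat f$ created by collapsing exactly $\pi\ge 1$ consecutive edges of $\hat f$ (the edges of $\hat f$ just before and just after them are not collapsed). If none of the Class 2 polygons $\hat f_e$ that contain one of these $\pi$ collapsed edges is itself collapsed to an edge, then $\hat v$ has degree $2\pi+4$ in the $1$-skeleton of the resulting complex. In general, if exactly $m$ of these Class 2 polygons are collapsed to an edge, then $\hat v$ has degree $2\pi+4-m$. -/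

import Mathlib

namespace EulerTransformation

/-- The Euclidean plane. -/
abbrev Plane : Type := EuclideanSpace ℝ (Fin 2)

/-- A polygonal region of the plane: a closed region with connected interior whose topological
boundary is a closed polygonal curve `vert 0, vert 1, …, vert (n - 1), vert 0` (indices modulo `n`).
Distinct sides meet only in common end points. The curve may pass through a vertex several times
(which happens for the outside of a complex at an articulation vertex), unless the region is
`Simple`. The region may be bounded (polygons, holes) or unbounded (the outside). -/
structure PolyCell where
  /-- number of sides -/
  n : ℕ
  three_le : 3 ≤ n
  /-- the corners in cyclic order -/
  vert : ZMod n → Plane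
  /-- the closed region -/
  region : Set Plane
  vert_ne : ∀ i, vert i ≠ vert (i + 1)
  side_inter : ∀ i j, i ≠ j →
    segment ℝ (vert i) (vert (i + 1)) ∩ segment ℝ (vert j) (vert (j + 1)) ⊆
      {vert i, vert (i + 1)} ∩ {vert j, vert (j + 1)}
  regular : closure (interior region) = region
  interior_connected : IsConnected (interior region)
  frontier_eq : frontier region = ⋃ i, segment ℝ (vert i) (vert (i + 1))

namespace PolyCell

/-- The `i`-th edge, as an unordered pair of vertices. -/
def edge (P : PolyCell) (i : ZMod P.n) : Sym2 Plane := s(P.vert i, P.vert (i + 1))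

/-- The `i`-th edge, as a segment in the plane. -/
def side (P : PolyCell) (i : ZMod P.n) : Set Plane := segment ℝ (P.vert i) (P.vert (i + 1))

/-- `v` is a vertex of `P`. -/
def HasVertex (P : PolyCell) (v : Plane) : Prop := ∃ i, P.vert i = v

/-- `e` is an edge of `P`. -/
def HasEdge (P : PolyCell) (e : Sym2 Plane) : Prop := ∃ i, P.edge i = e

/-- The boundary is a simple closed polygonal curve. -/
def Simple (P : PolyCell) : Prop := Function.Injective P.vert

/-- A polygon: bounded, with simple boundary; convexity is not required. -/
def IsPolygon (P : PolyCell) : Prop := P.Simple ∧ Bornology.IsBounded P.region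

/-- The intersection of the two regions is empty or a single common face (vertex or edge). -/
def MeetInFace (P Q : PolyCell) : Prop :=
  P.region ∩ Q.region = ∅ ∨
  (∃ v, P.HasVertex v ∧ Q.HasVertex v ∧ P.region ∩ Q.region = {v}) ∨
  (∃ i, Q.HasEdge (P.edge i) ∧ P.region ∩ Q.region = P.side i)

/-- The intersection of the two regions consists of common vertices and common edges. -/
def MeetInFaces (P Q : PolyCell) : Prop :=
  P.region ∩ Q.region =
    {v | P.HasVertex v ∧ Q.HasVertex v} ∪ {x | ∃ i, Q.HasEdge (P.edge i) ∧ x ∈ P.side i}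

end PolyCell

/-- An admissible input: a finite connected polygonal complex in the plane, given by its polygons
(so it is pure: its vertices and edges are those of its polygons), together with the holes and the
outside region. -/
structure InputComplex where
  /-- the polygons of the complex -/
  K : Set PolyCell
  /-- the holes -/
  holes : Set PolyCell
  /-- the outside -/
  outside : PolyCell
  finite_K : K.Finite
  finite_holes : holes.Finite
  isPolygon : ∀ P ∈ K, P.IsPolygon
  meet : ∀ P ∈ K, ∀ Q ∈ K, P ≠ Q → P.MeetInFace Q
  connected : IsConnected (⋃ P ∈ K, P.region)
  holes_bounded : ∀ h ∈ holes, Bornology.IsBounded h.region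
  outside_unbounded : ¬ Bornology.IsBounded outside.region
  meet_holes : ∀ P ∈ K, ∀ h ∈ holes, P.MeetInFaces h
  meet_outside : ∀ P ∈ K, P.MeetInFaces outside
  cover : (⋃ P ∈ K, P.region) ∪ (⋃ h ∈ holes, h.region) ∪ outside.region = Set.univ
  holes_disjoint : ∀ h ∈ holes, ∀ h' ∈ holes, h ≠ h' → Disjoint h.region h'.region
  holes_disjoint_outside : ∀ h ∈ holes, Disjoint h.region outside.region
  /-- a polygon shares at most one edge with a hole -/
  hole_edge : ∀ P ∈ K, ∀ h ∈ holes, ∀ i j,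
    h.HasEdge (P.edge i) → h.HasEdge (P.edge j) → i = j
  /-- a polygon does not share two adjacent edges with the outside -/
  outside_edge : ∀ P ∈ K, ∀ i,
    ¬ (outside.HasEdge (P.edge i) ∧ outside.HasEdge (P.edge (i + 1)))

namespace InputComplex

variable (M : InputComplex)

/-- The polygons of the complex, the holes and the outside. -/
def cells : Set PolyCell := M.K ∪ M.holes ∪ {M.outside}

/-- A vertex of the Euler transformation (before any collapse): the copy, in the duplicate of
`cell`, of the vertex `pt` of `cell`. -/
@[ext] structure Corner where
  cell : PolyCell
  pt : Plane
  mem : cell ∈ M.cells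
  isVertex : cell.HasVertex pt

/-- The facets of the Class 1 polygon that is the copy of `P`. -/
def copyFacets (P : PolyCell) : Set (Sym2 M.Corner) :=
  {z | ∃ x y : M.Corner, z = s(x, y) ∧ x.cell = P ∧ y.cell = P ∧ P.HasEdge s(x.pt, y.pt)}

/-- The vertices of the Class 2 polygon (4-gon) of the edge `e`: the copies of the two end points
of `e` in the two cells that contain `e`. -/
def fourGonVertices (e : Sym2 Plane) : Set M.Corner :=
  {x | x.cell.HasEdge e ∧ x.pt ∈ e}

/-- The facets of the Class 2 polygon of `e = {u, v}`: the two copies of `e`, and the two new edges,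
one joining the two copies of `u` and one joining the two copies of `v`. -/
def fourGonFacets (e : Sym2 Plane) : Set (Sym2 M.Corner) :=
  {z | ∃ x y : M.Corner, z = s(x, y) ∧ x ≠ y ∧ x ∈ M.fourGonVertices e ∧
    y ∈ M.fourGonVertices e ∧ (x.cell = y.cell ∨ x.pt = y.pt)}

/-- The facets of the Class 3 polygon of the vertex `v`: they join the copies of `v` in two
different cells with a common edge at `v`. -/
def vertexPolygonFacets (v : Plane) : Set (Sym2 M.Corner) :=
  {z | ∃ x y : M.Corner, z = s(x, y) ∧ x.pt = v ∧ y.pt = v ∧ x.cell ≠ y.cell ∧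
    ∃ e, v ∈ e ∧ x.cell.HasEdge e ∧ y.cell.HasEdge e}

/-- All edges of the Euler transformation (before any collapse): the facets of its polygons of the
three classes, which come from the polygons, the edges and the vertices of the complex. -/
def facets : Set (Sym2 M.Corner) :=
  (⋃ P ∈ M.K, M.copyFacets P) ∪
  (⋃ e ∈ {e : Sym2 Plane | ∃ P ∈ M.K, P.HasEdge e}, M.fourGonFacets e) ∪
  (⋃ v ∈ {v : Plane | ∃ P ∈ M.K, P.HasVertex v}, M.vertexPolygonFacets v)

/-- A pattern of combinatorial changes: in the copies of the polygons of the complex, some edges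
are collapsed, at least three edges of each polygon being kept; holes and the outside are left
unchanged. -/
structure CombinatorialChange where
  /-- the edges that are collapsed in the copy of `P` -/
  collapsed : (P : PolyCell) → Set (ZMod P.n)
  collapsed_eq_empty : ∀ P, P ∉ M.K → collapsed P = ∅
  three_le_kept : ∀ P ∈ M.K, 3 ≤ (collapsed P)ᶜ.ncard

namespace CombinatorialChange

variable {M} (c : M.CombinatorialChange)

/-- `x` and `y` are the two end points, in the copy of a polygon, of a collapsed edge. -/
def Glued (x y : M.Corner) : Prop :=
  x.cell = y.cell ∧ ∃ i ∈ c.collapsed x.cell, s(x.pt, y.pt) = x.cell.edge i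

/-- The vertices of the Euler transformation with combinatorial changes: the end points of each
collapsed edge are identified. -/
def Vertex : Type := Quot c.Glued

/-- The vertex that a vertex of the uncollapsed Euler transformation becomes. -/
def proj (x : M.Corner) : c.Vertex := Quot.mk _ x

/-- The `1`-skeleton of the Euler transformation with combinatorial changes (collapsed edges
disappear, and edges with the same two end points become one edge). -/
def skeleton : SimpleGraph c.Vertex :=
  SimpleGraph.fromEdgeSet (Sym2.map c.proj '' M.facets)

/-- The degree of a vertex in the `1`-skeleton. -/
noncomputable def degree (v : c.Vertex) : ℕ := (c.skeleton.neighborSet v).ncard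

/-- The Class 2 polygon of `e` is collapsed to an edge. -/
def FourGonCollapsesToEdge (e : Sym2 Plane) : Prop :=
  ∃ a b, c.skeleton.Adj a b ∧ c.proj '' M.fourGonVertices e = {a, b}

/-- `v` is the vertex of the copy of `P` that is created by collapsing the `k` adjacent edges
`i, i + 1, …, i + k - 1` of it (and no further ones: the edge before and the edge after them
are kept). -/
def CreatedByCollapsing (P : PolyCell) (i : ZMod P.n) (k : ℕ) (v : c.Vertex) : Prop :=
  1 ≤ k ∧ (∀ j < k, i + (j : ZMod P.n) ∈ c.collapsed P) ∧
  i - 1 ∉ c.collapsed P ∧ i + (k : ZMod P.n) ∉ c.collapsed P ∧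
  ∃ x : M.Corner, x.cell = P ∧ x.pt = P.vert i ∧ c.proj x = v

/-- The edges `i, i + 1, …, i + k - 1` of `P`. -/
def run (P : PolyCell) (i : ZMod P.n) (k : ℕ) : Set (Sym2 Plane) :=
  {e | ∃ j < k, e = P.edge (i + (j : ZMod P.n))}

end CombinatorialChange

end InputComplex

end EulerTransformation

namespace EulerTransformation

open Set Metric

/-! ### Midpoints of sides and common faces. -/

namespace PolyCell

/-! The vertex is the class of the `k + 1` consecutive corners `i, …, i + k` of the copy of `f`. Its
candidate neighbors are the classes of the corners `i - 1` and `i + k + 1` of `f`, and, for each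
corner of the class, its copies across the two edges of `f` at that corner. This gives `2 + 2 (k +
1) = 2 k + 4` candidates (`neighborSet_eq`), and the degree falls short of this only by
coincidences.

Geometrically, each edge of `f` lies in exactly one other cell (`exists_across`, `across_unique`).
Gluing never leaves a cell, so corners of `f` stay apart from corners across. A third kept edge
separates `i - 1` from `i + k + 1` (`proj_copy_pred_ne`). Two corners across different edges never
merge: a polygon or hole shares only one edge with `f`, and the outside is uncollapsed and shares no
adjacent edges with `f`. What remains is the merging of the two corners across one edge of the run,
which is exactly the collapse of its 4-gon to an edge (`fourGonCollapsesToEdge_iff`).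
Inclusion-exclusion gives the count. -/

instance (P : PolyCell) : NeZero P.n := ⟨by have := P.three_le; omega⟩

theorem isClosed_region (P : PolyCell) : IsClosed P.region := by
  rw [← P.regular]; exact isClosed_closure

theorem side_subset_frontier (P : PolyCell) (i : ZMod P.n) : P.side i ⊆ frontier P.region := by
  rw [P.frontier_eq]; exact subset_iUnion (fun i => segment ℝ (P.vert i) (P.vert (i + 1))) i

theorem side_subset_region (P : PolyCell) (i : ZMod P.n) : P.side i ⊆ P.region :=
  (P.side_subset_frontier i).trans P.isClosed_region.frontier_subset

theorem vert_mem_side (P : PolyCell) (i : ZMod P.n) : P.vert i ∈ P.side i :=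
  left_mem_segment ℝ _ _

theorem HasVertex.mem_frontier {P : PolyCell} {v : Plane} (h : P.HasVertex v) :
    v ∈ frontier P.region := by
  obtain ⟨i, rfl⟩ := h
  exact P.side_subset_frontier i (P.vert_mem_side i)

theorem HasEdge.hasVertex {P : PolyCell} {e : Sym2 Plane} (h : P.HasEdge e) {v : Plane}
    (hv : v ∈ e) : P.HasVertex v := by
  obtain ⟨i, rfl⟩ := h
  rcases Sym2.mem_iff.1 hv with rfl | rfl
  exacts [⟨i, rfl⟩, ⟨i + 1, rfl⟩]

theorem side_eq_of_edge_eq {P Q : PolyCell} {i : ZMod P.n} {j : ZMod Q.n}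
    (h : P.edge i = Q.edge j) : P.side i = Q.side j := by
  rcases Sym2.eq_iff.1 h with ⟨h₁, h₂⟩ | ⟨h₁, h₂⟩
  · rw [side, side, h₁, h₂]
  · rw [side, side, h₁, h₂, segment_symm]

/-- The midpoint of the `i`-th side. -/
noncomputable def mid (P : PolyCell) (i : ZMod P.n) : Plane :=
  midpoint ℝ (P.vert i) (P.vert (i + 1))

theorem mid_mem_side (P : PolyCell) (i : ZMod P.n) : P.mid i ∈ P.side i :=
  midpoint_mem_segment _ _

theorem mid_ne_left (P : PolyCell) (i : ZMod P.n) : P.mid i ≠ P.vert i := fun h =>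
  P.vert_ne i (by simpa [mid, midpoint_eq_left_iff] using h)

theorem mid_ne_right (P : PolyCell) (i : ZMod P.n) : P.mid i ≠ P.vert (i + 1) := fun h =>
  P.vert_ne i (by simpa [mid, midpoint_eq_right_iff] using h)

/-- Sides meet only in end points, so a midpoint determines its side. Midpoints serve below as
witnesses for edges. -/
theorem eq_of_mid_mem_side (P : PolyCell) {i j : ZMod P.n} (h : P.mid i ∈ P.side j) : i = j := by
  by_contra hij
  rcases (P.side_inter i j hij ⟨P.mid_mem_side i, h⟩).1 with h | h
  exacts [P.mid_ne_left i h, P.mid_ne_right i h]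

theorem not_hasVertex_mid (P : PolyCell) (i : ZMod P.n) : ¬ P.HasVertex (P.mid i) := by
  rintro ⟨j, hj⟩
  obtain rfl := P.eq_of_mid_mem_side (i := i) (j := j) (hj ▸ P.vert_mem_side j)
  exact P.mid_ne_left i hj.symm

theorem edge_injective (P : PolyCell) : Function.Injective P.edge := fun i _ h =>
  P.eq_of_mid_mem_side (side_eq_of_edge_eq h ▸ P.mid_mem_side i)

theorem mid_eq_of_edge_eq {P Q : PolyCell} {i : ZMod P.n} {j : ZMod Q.n}
    (h : P.edge i = Q.edge j) : P.mid i = Q.mid j := by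
  rcases Sym2.eq_iff.1 h with ⟨h₁, h₂⟩ | ⟨h₁, h₂⟩
  · rw [mid, mid, h₁, h₂]
  · rw [mid, mid, h₁, h₂, midpoint_comm]

theorem MeetInFace.inter_subset_frontier {P Q : PolyCell} (h : P.MeetInFace Q) :
    P.region ∩ Q.region ⊆ frontier P.region := by
  rcases h with h | ⟨v, hv, -, h⟩ | ⟨i, -, h⟩ <;> rw [h]
  · exact empty_subset _
  · exact singleton_subset_iff.2 hv.mem_frontier
  · exact P.side_subset_frontier i

theorem MeetInFaces.inter_subset_frontier {P Q : PolyCell} (h : P.MeetInFaces Q) :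
    P.region ∩ Q.region ⊆ frontier P.region := by
  rw [h]
  rintro x (hx | ⟨i, -, hx⟩)
  exacts [hx.1.mem_frontier, P.side_subset_frontier i hx]

/-- A midpoint is neither a vertex nor on another side, so the only common face that can contain it
is its own edge. -/
theorem MeetInFace.hasEdge {P Q : PolyCell} (h : P.MeetInFace Q) {i : ZMod P.n}
    (hi : P.mid i ∈ Q.region) : Q.HasEdge (P.edge i) := by
  have hm : P.mid i ∈ P.region ∩ Q.region := ⟨P.side_subset_region i (P.mid_mem_side i), hi⟩
  rcases h with h | ⟨v, hv, -, h⟩ | ⟨j, hj, h⟩ <;> rw [h] at hm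
  · exact hm.elim
  · exact (P.not_hasVertex_mid i (mem_singleton_iff.1 hm ▸ hv)).elim
  · exact P.eq_of_mid_mem_side hm ▸ hj

theorem MeetInFaces.hasEdge {P Q : PolyCell} (h : P.MeetInFaces Q) {i : ZMod P.n}
    (hi : P.mid i ∈ Q.region) : Q.HasEdge (P.edge i) := by
  have hm : P.mid i ∈ P.region ∩ Q.region := ⟨P.side_subset_region i (P.mid_mem_side i), hi⟩
  rw [h] at hm
  rcases hm with hm | ⟨j, hj, hm⟩
  · exact (P.not_hasVertex_mid i hm.1).elim
  · exact P.eq_of_mid_mem_side hm ▸ hj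

theorem HasEdge.side_subset {P Q : PolyCell} {i : ZMod P.n} (h : Q.HasEdge (P.edge i)) :
    P.side i ⊆ Q.region := by
  obtain ⟨j, hj⟩ := h
  rw [← side_eq_of_edge_eq hj]
  exact Q.side_subset_region j

theorem MeetInFace.edge_unique {P Q : PolyCell} (h : P.MeetInFace Q) {i j : ZMod P.n}
    (hi : Q.HasEdge (P.edge i)) (hj : Q.HasEdge (P.edge j)) : i = j := by
  have hm : ∀ {t}, Q.HasEdge (P.edge t) → P.mid t ∈ P.region ∩ Q.region := fun {t} ht =>
    ⟨P.side_subset_region t (P.mid_mem_side t), ht.side_subset (P.mid_mem_side t)⟩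
  have h₁ := hm hi
  have h₂ := hm hj
  rcases h with h | ⟨v, hv, -, h⟩ | ⟨t, -, h⟩ <;> rw [h] at h₁ h₂
  · exact h₁.elim
  · exact (P.not_hasVertex_mid i (mem_singleton_iff.1 h₁ ▸ hv)).elim
  · rw [P.eq_of_mid_mem_side h₁, P.eq_of_mid_mem_side h₂]

/-! ### Half discs at the midpoint of a side. -/

/-- A linear functional vanishing exactly in the direction `d`. -/
def transverse (d x : Plane) : ℝ := d 0 * x 1 - d 1 * x 0

theorem continuous_transverse (d : Plane) : Continuous (transverse d) := by
  unfold transverse; fun_prop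

theorem isLinearMap_transverse (d : Plane) : IsLinearMap ℝ (transverse d) := by
  constructor <;> intros <;> simp [transverse] <;> ring

theorem transverse_const_on_segment (a b : Plane) {x : Plane} (hx : x ∈ segment ℝ a b) :
    transverse (b - a) x = transverse (b - a) a := by
  obtain ⟨s, t, -, -, hst, rfl⟩ := hx
  obtain rfl : s = 1 - t := by linarith
  simp [transverse]; ring

/-- One can leave every point to either side of the line of direction `d`. -/
theorem exists_near_transverse {d : Plane} (hd : d ≠ 0) (ε : ℝ) (hε : ε = 1 ∨ ε = -1)
    {U : Set Plane} (hU : IsOpen U) {p : Plane} (hp : p ∈ U) :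
    ∃ x ∈ U, 0 < ε * (transverse d x - transverse d p) := by
  -- The quarter turn of `d`, scaled by `ε`, so that `transverse d w = ε |d|²`.
  let w : Plane := !₂[-(ε * d 1), ε * d 0]
  have hc : Continuous fun s : ℝ => p + s • w := by fun_prop
  have hnear : ∀ᶠ s in nhds (0 : ℝ), p + s • w ∈ U :=
    hc.continuousAt.eventually_mem (hU.mem_nhds (by simpa using hp))
  obtain ⟨s, hs, hs0⟩ := ((hnear.filter_mono nhdsWithin_le_nhds).and
    (self_mem_nhdsWithin (a := (0 : ℝ)) (s := Ioi 0))).exists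
  have hs0 : 0 < s := hs0
  refine ⟨_, hs, ?_⟩
  have hdd : 0 < d 0 ^ 2 + d 1 ^ 2 := by
    by_contra hneg
    apply hd
    ext j
    have h0 : d 0 = 0 := by nlinarith [sq_nonneg (d 0), sq_nonneg (d 1)]
    have h1 : d 1 = 0 := by nlinarith [sq_nonneg (d 0), sq_nonneg (d 1)]
    fin_cases j <;> simpa
  have hval : ε * (transverse d (p + s • w) - transverse d p) = ε ^ 2 * s * (d 0 ^ 2 + d 1 ^ 2) := by
    simp [transverse, w]; ring
  rw [hval]
  rcases hε with rfl | rfl <;> norm_num <;> positivity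

/-- The half disc of radius `r` at `p`, on one side of the line of direction `d`. -/
def halfDisc (p d : Plane) (r ε : ℝ) : Set Plane :=
  ball p r ∩ {x | 0 < ε * (transverse d x - transverse d p)}

theorem isOpen_halfDisc (p d : Plane) (r ε : ℝ) : IsOpen (halfDisc p d r ε) :=
  isOpen_ball.inter (isOpen_lt continuous_const
    (continuous_const.mul ((continuous_transverse d).sub continuous_const)))

theorem convex_halfDisc (p d : Plane) (r ε : ℝ) : Convex ℝ (halfDisc p d r ε) := by
  refine (convex_ball p r).inter ?_
  have := convex_halfSpace_gt (𝕜 := ℝ) (f := fun x => ε * transverse d x)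
    (by
      constructor
      · intro x y; rw [(isLinearMap_transverse d).map_add]; ring
      · intro s x; rw [(isLinearMap_transverse d).map_smul]; simp; ring) (ε * transverse d p)
  convert this using 3
  constructor <;> intro h <;> linarith

theorem halfDisc_mono {p d : Plane} {r r' ε : ℝ} (h : r ≤ r') :
    halfDisc p d r ε ⊆ halfDisc p d r' ε :=
  inter_subset_inter_left _ (ball_subset_ball h)

theorem halfDisc_nonempty {p d : Plane} (hd : d ≠ 0) {r ε : ℝ} (hr : 0 < r)
    (hε : ε = 1 ∨ ε = -1) : (halfDisc p d r ε).Nonempty := by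
  obtain ⟨x, hx, hx'⟩ := exists_near_transverse hd ε hε (isOpen_ball (x := p) (ε := r))
    (mem_ball_self hr)
  exact ⟨x, hx, hx'⟩

/-- A polygonal region contains a half disc at the midpoint of each of its sides. -/
theorem exists_halfDisc_subset (P : PolyCell) (i : ZMod P.n) :
    ∃ r > 0, ∃ ε : ℝ, (ε = 1 ∨ ε = -1) ∧
      halfDisc (P.mid i) (P.vert (i + 1) - P.vert i) r ε ⊆ P.region := by
  set p := P.mid i
  set d := P.vert (i + 1) - P.vert i
  have hd : d ≠ 0 := sub_ne_zero.2 (P.vert_ne i).symm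
  have hclosed : IsClosed (⋃ j ∈ {j | j ≠ i}, P.side j) :=
    (Set.toFinite _).isClosed_biUnion fun j _ => by
      have : IsCompact (P.side j) := by
        rw [side, ← convexHull_pair]
        exact (Set.toFinite {P.vert j, P.vert (j + 1)}).isCompact_convexHull (𝕜 := ℝ)
      exact this.isClosed
  have hp : p ∈ (⋃ j ∈ {j | j ≠ i}, P.side j)ᶜ := by
    simp only [mem_compl_iff, mem_iUnion, not_exists]
    exact fun j hj h => hj (P.eq_of_mid_mem_side h).symm
  obtain ⟨r, hr, hball⟩ := Metric.isOpen_iff.1 hclosed.isOpen_compl p hp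
  have hfr : ∀ x ∈ ball p r, x ∈ frontier P.region → x ∈ P.side i := by
    intro x hx hxf
    rw [P.frontier_eq] at hxf
    obtain ⟨j, hj⟩ := mem_iUnion.1 hxf
    by_cases hji : j = i
    · subst hji; exact hj
    · exact (hball hx (mem_biUnion (show j ∈ {j | j ≠ i} from hji) hj)).elim
  have hconst : ∀ x ∈ P.side i, transverse d x = transverse d p := fun x hx =>
    (transverse_const_on_segment _ _ hx).trans
      (transverse_const_on_segment _ _ (P.mid_mem_side i)).symm
  -- A half disc misses the line of the side, hence the frontier; being connected, it lies in the
  -- region once it meets it.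
  have hall : ∀ ε : ℝ, (halfDisc p d r ε ∩ P.region).Nonempty → halfDisc p d r ε ⊆ P.region := by
    intro ε hne
    by_contra hnot
    obtain ⟨y, hy, hyP⟩ := not_subset.1 hnot
    obtain ⟨z, hz, hzf⟩ : ∃ z ∈ halfDisc p d r ε, z ∈ frontier P.region := by
      by_contra! hno
      have hint : ∀ z ∈ halfDisc p d r ε, z ∈ P.region → z ∈ interior P.region := fun z hz hzP =>
        by_contra fun h => hno z hz (P.isClosed_region.frontier_eq ▸ ⟨hzP, h⟩)
      obtain ⟨x, hx, hxP⟩ := hne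
      obtain ⟨z, -, hz, hz'⟩ := (convex_halfDisc p d r ε).isPreconnected _ _ isOpen_interior
        P.isClosed_region.isOpen_compl
        (fun z hz => (em (z ∈ P.region)).imp (hint z hz) id) ⟨x, hx, hint x hx hxP⟩ ⟨y, hy, hyP⟩
      exact hz' (interior_subset hz)
    have := hz.2
    rw [mem_ofPred_eq, hconst z (hfr z hz.1 hzf)] at this
    simp at this
  have hpc : p ∈ closure (interior P.region) := by
    rw [P.regular]; exact P.side_subset_region i (P.mid_mem_side i)
  -- Regularity gives an interior point near `p`; if it is on the line, it is pushed off inside the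
  -- open set and so lands in a half disc.
  obtain ⟨y, hyb, hyi⟩ := mem_closure_iff.1 hpc _ isOpen_ball (mem_ball_self hr)
  obtain ⟨x, ⟨hxb, hxi⟩, hx⟩ : ∃ x ∈ ball p r ∩ interior P.region,
      transverse d x ≠ transverse d p := by
    by_cases hy : transverse d y = transverse d p
    · obtain ⟨x, hx, hx'⟩ := exists_near_transverse hd 1 (Or.inl rfl)
        (isOpen_ball.inter isOpen_interior) ⟨hyb, hyi⟩
      exact ⟨x, hx, fun h => by rw [h, hy] at hx'; simp at hx'⟩
    · exact ⟨y, ⟨hyb, hyi⟩, hy⟩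
  rcases lt_or_gt_of_ne hx with hx | hx
  · exact ⟨r, hr, -1, Or.inr rfl, hall _ ⟨x, ⟨hxb, by simp; linarith⟩, interior_subset hxi⟩⟩
  · exact ⟨r, hr, 1, Or.inl rfl, hall _ ⟨x, ⟨hxb, by simp; linarith⟩, interior_subset hxi⟩⟩

/-- `Q` may traverse the edge in the opposite direction; reversing the direction exchanges the two
half discs, hence the sign change. -/
theorem exists_halfDisc_subset_of_hasEdge {P Q : PolyCell} {i : ZMod P.n}
    (h : Q.HasEdge (P.edge i)) :
    ∃ r > 0, ∃ ε : ℝ, (ε = 1 ∨ ε = -1) ∧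
      halfDisc (P.mid i) (P.vert (i + 1) - P.vert i) r ε ⊆ Q.region := by
  obtain ⟨j, hj⟩ := h
  obtain ⟨r, hr, ε, hε, hsub⟩ := Q.exists_halfDisc_subset j
  rw [mid_eq_of_edge_eq hj] at hsub
  rcases Sym2.eq_iff.1 hj with ⟨h₁, h₂⟩ | ⟨h₁, h₂⟩
  · exact ⟨r, hr, ε, hε, by rwa [h₁, h₂] at hsub⟩
  · refine ⟨r, hr, -ε, by rcases hε with rfl | rfl <;> simp, ?_⟩
    rw [h₁, h₂] at hsub
    refine subset_trans ?_ hsub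
    rintro x ⟨hx, hx'⟩
    refine ⟨hx, ?_⟩
    simp only [mem_ofPred_eq, transverse, PiLp.sub_apply] at hx' ⊢
    linarith

/-- Among three cells with a common edge, two have a common interior point. -/
theorem exists_open_subset_inter {P Q R : PolyCell} {i : ZMod P.n} (hQ : Q.HasEdge (P.edge i))
    (hR : R.HasEdge (P.edge i)) :
    ∃ U : Set Plane, IsOpen U ∧ U.Nonempty ∧ (U ⊆ P.region ∩ Q.region ∨
      U ⊆ P.region ∩ R.region ∨ U ⊆ Q.region ∩ R.region) := by
  have hd : P.vert (i + 1) - P.vert i ≠ 0 := sub_ne_zero.2 (P.vert_ne i).symm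
  obtain ⟨r₁, hr₁, ε₁, hε₁, h₁⟩ := P.exists_halfDisc_subset i
  obtain ⟨r₂, hr₂, ε₂, hε₂, h₂⟩ := exists_halfDisc_subset_of_hasEdge hQ
  obtain ⟨r₃, hr₃, ε₃, hε₃, h₃⟩ := exists_halfDisc_subset_of_hasEdge hR
  have key : ∀ {r r' : ℝ} {A B : Set Plane} {ε ε' : ℝ}, 0 < r → 0 < r' → (ε = 1 ∨ ε = -1) →
      halfDisc (P.mid i) (P.vert (i + 1) - P.vert i) r ε ⊆ A →
      halfDisc (P.mid i) (P.vert (i + 1) - P.vert i) r' ε' ⊆ B → ε = ε' →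
      ∃ U : Set Plane, IsOpen U ∧ U.Nonempty ∧ U ⊆ A ∩ B := by
    rintro r r' A B ε _ hr hr' hε hA hB rfl
    exact ⟨_, isOpen_halfDisc _ _ (min r r') _, halfDisc_nonempty hd (lt_min hr hr') hε,
      subset_inter ((halfDisc_mono (min_le_left _ _)).trans hA)
        ((halfDisc_mono (min_le_right _ _)).trans hB)⟩
  -- Pigeonhole: three cells, two sides of the edge.
  have : ε₁ = ε₂ ∨ ε₁ = ε₃ ∨ ε₂ = ε₃ := by
    rcases hε₁ with rfl | rfl <;> rcases hε₂ with rfl | rfl <;> rcases hε₃ with rfl | rfl <;> simp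
  rcases this with h | h | h
  · obtain ⟨U, hU, hne, hs⟩ := key hr₁ hr₂ hε₁ h₁ h₂ h
    exact ⟨U, hU, hne, Or.inl hs⟩
  · obtain ⟨U, hU, hne, hs⟩ := key hr₁ hr₃ hε₁ h₁ h₃ h
    exact ⟨U, hU, hne, Or.inr (Or.inl hs)⟩
  · obtain ⟨U, hU, hne, hs⟩ := key hr₂ hr₃ hε₂ h₂ h₃ h
    exact ⟨U, hU, hne, Or.inr (Or.inr hs)⟩

end PolyCell

/-! ### The two cells at an edge of the complex. -/

namespace InputComplex

variable (M : InputComplex)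

theorem finite_cells : M.cells.Finite :=
  (M.finite_K.union M.finite_holes).union (finite_singleton _)

theorem exists_cell_mem (x : Plane) : ∃ Q ∈ M.cells, x ∈ Q.region := by
  have hx : x ∈ (⋃ P ∈ M.K, P.region) ∪ (⋃ h ∈ M.holes, h.region) ∪ M.outside.region :=
    M.cover ▸ mem_univ x
  simp only [mem_union, mem_iUnion, exists_prop] at hx
  rcases hx with (⟨Q, hQ, h⟩ | ⟨Q, hQ, h⟩) | h
  exacts [⟨Q, Or.inl (Or.inl hQ), h⟩, ⟨Q, Or.inl (Or.inr hQ), h⟩, ⟨_, Or.inr rfl, h⟩]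

theorem outside_notMem_K : M.outside ∉ M.K := fun h =>
  M.outside_unbounded (M.isPolygon _ h).2

variable {M}

theorem inter_subset_frontier {P Q : PolyCell} (hP : P ∈ M.K) (hQ : Q ∈ M.cells) (hne : P ≠ Q) :
    P.region ∩ Q.region ⊆ frontier P.region := by
  rcases hQ with (hQ | hQ) | rfl
  · exact (M.meet P hP Q hQ hne).inter_subset_frontier
  · exact (M.meet_holes P hP Q hQ).inter_subset_frontier
  · exact (M.meet_outside P hP).inter_subset_frontier

theorem hasEdge_of_mid_mem {P Q : PolyCell} (hP : P ∈ M.K) (hQ : Q ∈ M.cells) (hne : P ≠ Q)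
    {i : ZMod P.n} (hi : P.mid i ∈ Q.region) : Q.HasEdge (P.edge i) := by
  rcases hQ with (hQ | hQ) | rfl
  · exact (M.meet P hP Q hQ hne).hasEdge hi
  · exact (M.meet_holes P hP Q hQ).hasEdge hi
  · exact (M.meet_outside P hP).hasEdge hi

/-- Two different cells have no common interior point. -/
theorem eq_empty_of_subset_inter {P Q : PolyCell} (hP : P ∈ M.cells) (hQ : Q ∈ M.cells)
    (hne : P ≠ Q) {U : Set Plane} (hU : IsOpen U) (h : U ⊆ P.region ∩ Q.region) : U = ∅ := by
  -- An open set in both regions would lie in the interior and in the frontier of `P`.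
  have key : ∀ {P Q : PolyCell}, P ∈ M.K → Q ∈ M.cells → P ≠ Q → U ⊆ P.region ∩ Q.region →
      U = ∅ := by
    intro P Q hP hQ hne h
    have h₁ : U ⊆ interior P.region := interior_maximal (h.trans inter_subset_left) hU
    have h₂ := h.trans (inter_subset_frontier hP hQ hne)
    exact subset_empty_iff.1 ((subset_inter h₁ h₂).trans disjoint_interior_frontier.inter_eq.subset)
  by_cases hPK : P ∈ M.K
  · exact key hPK hQ hne h
  by_cases hQK : Q ∈ M.K
  · exact key hQK hP hne.symm (inter_comm P.region Q.region ▸ h)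
  have hdis : Disjoint P.region Q.region := by
    rcases hP with (hP | hP) | rfl
    · exact (hPK hP).elim
    · rcases hQ with (hQ | hQ) | rfl
      · exact (hQK hQ).elim
      · exact M.holes_disjoint P hP Q hQ hne
      · exact M.holes_disjoint_outside P hP
    · rcases hQ with (hQ | hQ) | rfl
      · exact (hQK hQ).elim
      · exact (M.holes_disjoint_outside Q hQ).symm
      · exact (hne rfl).elim
  exact subset_empty_iff.1 (h.trans hdis.inter_eq.subset)

/-- An edge of a polygon of the complex lies in a second cell. -/
theorem exists_across {P : PolyCell} (hP : P ∈ M.K) (i : ZMod P.n) :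
    ∃ Q ∈ M.cells, Q ≠ P ∧ Q.HasEdge (P.edge i) := by
  have hcl : IsClosed (⋃ Q ∈ M.cells \ {P}, Q.region) :=
    (M.finite_cells.subset sdiff_subset).isClosed_biUnion fun Q _ => Q.isClosed_region
  have hsub : P.regionᶜ ⊆ ⋃ Q ∈ M.cells \ {P}, Q.region := by
    intro x hx
    obtain ⟨Q, hQ, hxQ⟩ := M.exists_cell_mem x
    exact mem_biUnion (show Q ∈ M.cells \ {P} from ⟨hQ, by rintro rfl; exact hx hxQ⟩) hxQ
  -- The midpoint is a limit of points outside `P`, which lie in the closed union of the finitely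
  -- many other cells.
  have hfr := P.side_subset_frontier i (P.mid_mem_side i)
  rw [frontier_eq_closure_inter_closure] at hfr
  have := closure_minimal hsub hcl hfr.2
  simp only [mem_iUnion] at this
  obtain ⟨Q, ⟨hQ, hne⟩, hm⟩ := this
  exact ⟨Q, hQ, hne, hasEdge_of_mid_mem hP hQ (Ne.symm hne) hm⟩

/-- An edge of a polygon of the complex lies in at most one other cell. -/
theorem across_unique {P Q R : PolyCell} (hP : P ∈ M.K) {i : ZMod P.n} (hQ : Q ∈ M.cells)
    (hQP : Q ≠ P) (hQi : Q.HasEdge (P.edge i)) (hR : R ∈ M.cells) (hRP : R ≠ P)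
    (hRi : R.HasEdge (P.edge i)) : Q = R := by
  by_contra hQR
  have hP' : P ∈ M.cells := Or.inl (Or.inl hP)
  obtain ⟨U, hU, hne, h | h | h⟩ := PolyCell.exists_open_subset_inter hQi hRi
  · exact hne.ne_empty (eq_empty_of_subset_inter hP' hQ hQP.symm hU h)
  · exact hne.ne_empty (eq_empty_of_subset_inter hP' hR hRP.symm hU h)
  · exact hne.ne_empty (eq_empty_of_subset_inter hQ hR hQR hU h)

/-- Only the outside can share several edges with a polygon. -/
theorem eq_or_eq_outside_of_hasEdge {P Q : PolyCell} (hP : P ∈ M.K) (hQ : Q ∈ M.cells)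
    (hne : Q ≠ P) {i j : ZMod P.n} (hi : Q.HasEdge (P.edge i)) (hj : Q.HasEdge (P.edge j)) :
    i = j ∨ Q = M.outside := by
  rcases hQ with (hQ | hQ) | rfl
  · exact Or.inl ((M.meet P hP Q hQ hne.symm).edge_unique hi hj)
  · exact Or.inl (M.hole_edge P hP Q hQ i j hi hj)
  · exact Or.inr rfl

/-- No cell shares two adjacent edges with a polygon. -/
theorem not_hasEdge_adjacent {P Q : PolyCell} (hP : P ∈ M.K) (hQ : Q ∈ M.cells)
    (hne : Q ≠ P) {i : ZMod P.n} (hi : Q.HasEdge (P.edge i)) : ¬ Q.HasEdge (P.edge (i + 1)) := by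
  intro hj
  rcases eq_or_eq_outside_of_hasEdge hP hQ hne hi hj with h | rfl
  · have h1 : (1 : ZMod P.n) = 0 := by simpa using h
    have := ZMod.one_eq_zero_iff.1 h1
    have := P.three_le
    omega
  · exact M.outside_edge P hP i ⟨hi, hj⟩

end InputComplex

theorem PolyCell.vert_mem_edge_iff {P : PolyCell} (hP : P.Simple) {s t : ZMod P.n} :
    P.vert s ∈ P.edge t ↔ s = t ∨ s = t + 1 := by
  rw [PolyCell.edge, Sym2.mem_iff, hP.eq_iff, hP.eq_iff]

theorem _root_.ZMod.natCast_inj_of_lt {n a b : ℕ} (ha : a < n) (hb : b < n)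
    (h : (a : ZMod n) = b) : a = b := by
  rw [ZMod.natCast_eq_natCast_iff', Nat.mod_eq_of_lt ha, Nat.mod_eq_of_lt hb] at h
  exact h

/-! ### Adjacency before the collapse. -/

namespace InputComplex

variable {M : InputComplex}

theorem mem_cells_of_mem_K {P : PolyCell} (hP : P ∈ M.K) : P ∈ M.cells := Or.inl (Or.inl hP)

/-- The copy of the `t`-th vertex of a polygon. -/
def copy {P : PolyCell} (hP : P ∈ M.K) (t : ZMod P.n) : M.Corner :=
  ⟨P, P.vert t, mem_cells_of_mem_K hP, ⟨t, rfl⟩⟩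

/-- Adjacency of vertices of the Euler transformation: along an edge of a cell, or across an
edge. -/
def Linked (x y : M.Corner) : Prop :=
  (x.cell = y.cell ∧ x.cell.HasEdge s(x.pt, y.pt)) ∨
  (x.pt = y.pt ∧ x.cell ≠ y.cell ∧ ∃ e, x.pt ∈ e ∧ x.cell.HasEdge e ∧ y.cell.HasEdge e)

theorem Linked.symm {x y : M.Corner} (h : Linked x y) : Linked y x := by
  rcases h with ⟨h, he⟩ | ⟨h, hne, e, hx, he, he'⟩
  · exact Or.inl ⟨h.symm, by rwa [Sym2.eq_swap, ← h]⟩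
  · exact Or.inr ⟨h.symm, hne.symm, e, h ▸ hx, he', he⟩

theorem linked_of_mem_facets {x y : M.Corner} (h : s(x, y) ∈ M.facets) : Linked x y := by
  have key : ∀ {a b : M.Corner}, s(x, y) = s(a, b) → Linked a b → Linked x y := by
    intro a b hab hl
    rcases Sym2.eq_iff.1 hab with ⟨rfl, rfl⟩ | ⟨rfl, rfl⟩
    exacts [hl, hl.symm]
  rcases h with (h | h) | h <;> simp only [mem_iUnion] at h
  · obtain ⟨P, -, a, b, hab, rfl, hb, he⟩ := h
    exact key hab (Or.inl ⟨hb.symm, he⟩)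
  · obtain ⟨e, -, a, b, hab, hne, ⟨ha, hae⟩, ⟨hb, hbe⟩, hc⟩ := h
    refine key hab ?_
    by_cases hcell : a.cell = b.cell
    · refine Or.inl ⟨hcell, ?_⟩
      have hpt : a.pt ≠ b.pt := fun h => hne (Corner.ext hcell h)
      rwa [← (Sym2.mem_and_mem_iff hpt).1 ⟨hae, hbe⟩]
    · exact Or.inr ⟨hc.resolve_left hcell, hcell, e, hae, ha, hb⟩
  · obtain ⟨v, -, a, b, hab, ha, hb, hne, e, hve, hea, heb⟩ := h
    exact key hab (Or.inr ⟨ha.trans hb.symm, hne, e, ha ▸ hve, hea, heb⟩)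

/-- Only polygons of the complex have Class 1 copies, hence the condition on `x.cell`; Classes 1 and
3 then already supply every link. -/
theorem Linked.mem_facets {x y : M.Corner} (h : Linked x y) (hx : x.cell ∈ M.K) :
    s(x, y) ∈ M.facets := by
  rcases h with ⟨h, he⟩ | ⟨h, hne, e, hxe, he, he'⟩
  · exact Or.inl (Or.inl (mem_biUnion hx ⟨x, y, rfl, rfl, h.symm, he⟩))
  · exact Or.inr (mem_biUnion (show x.pt ∈ {v : Plane | ∃ P ∈ M.K, P.HasVertex v} from
      ⟨_, hx, x.isVertex⟩) ⟨x, y, rfl, rfl, h.symm, hne, e, hxe, he, he'⟩)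

/-! ### Which corners are identified. -/

namespace CombinatorialChange

variable (c : M.CombinatorialChange)

theorem adj_iff {v w : c.Vertex} : c.skeleton.Adj v w ↔
    v ≠ w ∧ ∃ x y, c.proj x = v ∧ c.proj y = w ∧ s(x, y) ∈ M.facets := by
  rw [skeleton, SimpleGraph.fromEdgeSet_adj, and_comm]
  refine and_congr_right fun _ => ⟨?_, ?_⟩
  · rintro ⟨z, hz, h⟩
    induction z with | _ x y => ?_
    rw [Sym2.map_mk] at h
    rcases Sym2.eq_iff.1 h with ⟨h₁, h₂⟩ | ⟨h₁, h₂⟩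
    · exact ⟨x, y, h₁, h₂, hz⟩
    · exact ⟨y, x, h₂, h₁, Sym2.eq_swap ▸ hz⟩
  · rintro ⟨x, y, rfl, rfl, h⟩
    exact ⟨_, h, rfl⟩

variable {c}

/-- A predicate constant on glued pairs descends to `Quot`. Vertices are told apart by such
invariants, without describing the generated equivalence relation. -/
theorem iff_of_proj_eq {S : M.Corner → Prop} (hS : ∀ x y, c.Glued x y → (S x ↔ S y))
    {x y : M.Corner} (h : c.proj x = c.proj y) : S x ↔ S y :=
  iff_of_eq (congrArg (Quot.lift S fun a b hab => propext (hS a b hab)) h)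

theorem cell_eq_of_proj_eq {x y : M.Corner} (h : c.proj x = c.proj y) : x.cell = y.cell :=
  (iff_of_proj_eq (S := fun z => z.cell = y.cell) (fun _ _ hab => by simp [hab.1]) h).2 rfl

theorem eq_of_proj_eq {x y : M.Corner} (hy : y.cell ∉ M.K) (h : c.proj x = c.proj y) :
    x = y := by
  refine (iff_of_proj_eq (S := fun z => z = y) (fun a b hab => ?_) h).2 rfl
  obtain ⟨hcell, i, hi, -⟩ := hab
  have hn : a.cell ∈ M.K := by
    by_contra hn
    rw [c.collapsed_eq_empty _ hn] at hi
    exact hi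
  constructor
  · rintro rfl; exact (hy hn).elim
  · rintro rfl; exact (hy (hcell ▸ hn)).elim

/-- A set of indices of vertices of `P` that is a union of classes of identified vertices. -/
def Saturated (c : M.CombinatorialChange) (P : PolyCell) (T : Set (ZMod P.n)) : Prop :=
  ∀ t ∈ c.collapsed P, (t ∈ T ↔ t + 1 ∈ T)

theorem Saturated.exists_of_proj_eq {P : PolyCell} (hP : P ∈ M.K) {T : Set (ZMod P.n)}
    (hT : c.Saturated P T) {t : ZMod P.n} (ht : t ∈ T) {x : M.Corner}
    (h : c.proj x = c.proj (copy hP t)) : ∃ s ∈ T, x = copy hP s := by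
  refine (iff_of_proj_eq (S := fun z => ∃ s ∈ T, z = copy hP s) (fun a b hab => ?_) h).2
    ⟨t, ht, rfl⟩
  have hs := (M.isPolygon P hP).1
  obtain ⟨ac, ap, ham, hav⟩ := a
  obtain ⟨bc, bp, hbm, hbv⟩ := b
  obtain ⟨hcell, i, hi, he⟩ := hab
  dsimp only at hcell hi he
  subst hcell
  have key : ∀ {q m hv} {s}, (⟨ac, q, m, hv⟩ : M.Corner) = copy hP s → ac = P :=
    fun h => congrArg Corner.cell h
  by_cases hac : ac = P
  · subst hac
    have hcopy : ∀ {q m hv} {s}, (⟨ac, q, m, hv⟩ : M.Corner) = copy hP s ↔ q = ac.vert s :=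
      fun {q m hv s} => ⟨fun h => congrArg Corner.pt h, fun h => Corner.ext rfl h⟩
    simp only [hcopy]
    have hsat := hT i hi
    rcases Sym2.eq_iff.1 he with ⟨h₁, h₂⟩ | ⟨h₁, h₂⟩ <;> simp [h₁, h₂, hs.eq_iff, hsat]
  · exact ⟨fun ⟨s, _, h⟩ => (hac (key h)).elim, fun ⟨s, _, h⟩ => (hac (key h)).elim⟩

theorem Saturated.proj_ne {P : PolyCell} (hP : P ∈ M.K) {T : Set (ZMod P.n)}
    (hT : c.Saturated P T) {s t : ZMod P.n} (hs : s ∉ T) (ht : t ∈ T) :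
    c.proj (copy hP s) ≠ c.proj (copy hP t) := by
  intro h
  obtain ⟨r, hr, h⟩ := hT.exists_of_proj_eq hP ht h
  have : P.vert s = P.vert r := congrArg Corner.pt h
  exact hs ((M.isPolygon P hP).1 this ▸ hr)

/-- The edges bounding the arc are kept, so no gluing crosses its ends. -/
theorem saturated_arc {P : PolyCell} {i : ZMod P.n} {k : ℕ} (h₁ : i - 1 ∉ c.collapsed P)
    (h₂ : i + (k : ZMod P.n) ∉ c.collapsed P) :
    c.Saturated P {t | ∃ j ≤ k, t = i + (j : ZMod P.n)} := by
  intro t ht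
  constructor
  · rintro ⟨j, hj, rfl⟩
    rcases hj.eq_or_lt with rfl | hj
    · exact (h₂ ht).elim
    · exact ⟨j + 1, hj, by push_cast; ring⟩
  · rintro ⟨j, hj, h⟩
    obtain rfl : t = i + (j : ZMod P.n) - 1 := by rw [← h]; ring
    rcases j with - | j
    · simp [h₁] at ht
    · exact ⟨j, by omega, by push_cast; ring⟩

theorem proj_copy_succ {P : PolyCell} (hP : P ∈ M.K) {t : ZMod P.n} (ht : t ∈ c.collapsed P) :
    c.proj (copy hP (t + 1)) = c.proj (copy hP t) :=
  (Quot.sound ⟨rfl, t, ht, rfl⟩ : c.proj (copy hP t) = c.proj (copy hP (t + 1))).symm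

theorem proj_copy_arc {P : PolyCell} (hP : P ∈ M.K) {i : ZMod P.n} {k : ℕ}
    (h : ∀ j < k, i + (j : ZMod P.n) ∈ c.collapsed P) {j : ℕ} (hj : j ≤ k) :
    c.proj (copy hP (i + (j : ZMod P.n))) = c.proj (copy hP i) := by
  induction j with
  | zero => simp
  | succ j ih =>
    rw [← ih (by omega), ← proj_copy_succ hP (h j (by omega))]
    push_cast
    rw [add_assoc]

/-- A third kept edge behind the kept edges before and after a run of collapsed edges. -/
theorem exists_kept {P : PolyCell} (hP : P ∈ M.K) {i : ZMod P.n} {k : ℕ}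
    (h : ∀ j < k, i + (j : ZMod P.n) ∈ c.collapsed P) :
    ∃ l, k < l ∧ l + 1 < P.n ∧ i + (l : ZMod P.n) ∉ c.collapsed P := by
  have h3 := c.three_le_kept P hP
  have hlt : ({i - 1, i + (k : ZMod P.n)} : Set (ZMod P.n)).ncard < (c.collapsed P)ᶜ.ncard :=
    ((ncard_insert_le _ _).trans (by rw [ncard_singleton])).trans_lt h3
  obtain ⟨q, hq, hq'⟩ := exists_mem_notMem_of_ncard_lt_ncard hlt
  simp only [mem_insert_iff, mem_singleton_iff, not_or] at hq'
  have hval : q = i + (((q - i).val : ℕ) : ZMod P.n) := by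
    rw [ZMod.natCast_val, ZMod.cast_id]; ring
  have hl := ZMod.val_lt (q - i)
  generalize (q - i).val = l at hval hl
  subst hval
  -- Offsets below `k` are collapsed, and offsets `k` and `n - 1` are the two edges excluded in
  -- choosing `q`.
  refine ⟨l, ?_, ?_, hq⟩
  · by_contra hkl
    rcases (not_lt.1 hkl).eq_or_lt with rfl | hkl
    · exact hq'.2 rfl
    · exact hq (h l hkl)
  · by_contra hln
    have : ((l + 1 : ℕ) : ZMod P.n) = 0 := by
      rw [show l + 1 = P.n by omega, ZMod.natCast_self]
    apply hq'.1
    push_cast at this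
    rw [eq_neg_of_add_eq_zero_left this]; ring

/-! ### Neighbors of the vertex created by a run. -/

section Run

variable {f : PolyCell} (hf : f ∈ M.K)

/-- The cell on the other side of the `t`-th edge of a polygon. -/
noncomputable def across (t : ZMod f.n) : PolyCell := (exists_across hf t).choose

theorem across_mem (t : ZMod f.n) : across hf t ∈ M.cells := (exists_across hf t).choose_spec.1

theorem across_ne (t : ZMod f.n) : across hf t ≠ f := (exists_across hf t).choose_spec.2.1

theorem across_hasEdge (t : ZMod f.n) : (across hf t).HasEdge (f.edge t) :=
  (exists_across hf t).choose_spec.2.2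

theorem eq_across {t : ZMod f.n} {Q : PolyCell} (hQ : Q ∈ M.cells) (hne : Q ≠ f)
    (h : Q.HasEdge (f.edge t)) : Q = across hf t :=
  across_unique hf hQ hne h (across_mem hf t) (across_ne hf t) (across_hasEdge hf t)

/-- The copy, across the `t`-th edge of a polygon, of the first end point of this edge. -/
noncomputable def acrossLeft (t : ZMod f.n) : M.Corner :=
  ⟨across hf t, f.vert t, across_mem hf t, (across_hasEdge hf t).hasVertex (Sym2.mem_mk_left _ _)⟩

/-- The copy, across the `t`-th edge of a polygon, of the second end point of this edge. -/
noncomputable def acrossRight (t : ZMod f.n) : M.Corner :=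
  ⟨across hf t, f.vert (t + 1), across_mem hf t,
    (across_hasEdge hf t).hasVertex (Sym2.mem_mk_right _ _)⟩

/-- Merged corners share a cell. If this cell meets several edges of `f`, it is the outside, where
nothing is glued and the corners are equal. -/
theorem eq_or_pt_eq_of_proj_eq {x y : M.Corner} {s t : ZMod f.n} (hx : x.cell = across hf s)
    (hy : y.cell = across hf t) (h : c.proj x = c.proj y) : s = t ∨ x.pt = y.pt := by
  have hcell : across hf s = across hf t := by rw [← hx, ← hy]; exact cell_eq_of_proj_eq h
  rcases eq_or_eq_outside_of_hasEdge hf (across_mem hf t) (across_ne hf t)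
    (hcell ▸ across_hasEdge hf s) (across_hasEdge hf t) with h' | h'
  · exact Or.inl h'
  · refine Or.inr (congrArg Corner.pt (eq_of_proj_eq ?_ h))
    rw [hy, h']
    exact M.outside_notMem_K

theorem proj_acrossLeft_injective : Function.Injective fun t => c.proj (acrossLeft hf t) :=
  fun _ _ h => (eq_or_pt_eq_of_proj_eq hf rfl rfl h).elim id
    fun h => (M.isPolygon f hf).1 h

theorem proj_acrossRight_injective : Function.Injective fun t => c.proj (acrossRight hf t) :=
  fun _ _ h => (eq_or_pt_eq_of_proj_eq hf rfl rfl h).elim id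
    fun h => add_right_cancel ((M.isPolygon f hf).1 h)

/-- Otherwise the points agree, so `s = t + 1`, and one cell would share two adjacent edges with
`f`. -/
theorem eq_of_proj_acrossLeft_eq {s t : ZMod f.n}
    (h : c.proj (acrossLeft hf s) = c.proj (acrossRight hf t)) : s = t := by
  refine (eq_or_pt_eq_of_proj_eq hf rfl rfl h).elim id fun h' => ?_
  obtain rfl : s = t + 1 := (M.isPolygon f hf).1 h'
  have hcell : across hf (t + 1) = across hf t := cell_eq_of_proj_eq h
  exact (not_hasEdge_adjacent hf (across_mem hf t) (across_ne hf t) (across_hasEdge hf t)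
    (hcell ▸ across_hasEdge hf (t + 1))).elim

theorem fourGonVertices_eq (t : ZMod f.n) : M.fourGonVertices (f.edge t) =
    {copy hf t, copy hf (t + 1), acrossLeft hf t, acrossRight hf t} := by
  ext x
  simp only [fourGonVertices, mem_ofPred_eq, mem_insert_iff, mem_singleton_iff]
  constructor
  · rintro ⟨he, hx⟩
    by_cases hxf : x.cell = f
    · rcases Sym2.mem_iff.1 hx with h | h
      · exact Or.inl (Corner.ext hxf h)
      · exact Or.inr (Or.inl (Corner.ext hxf h))
    · have := eq_across hf x.mem hxf he
      rcases Sym2.mem_iff.1 hx with h | h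
      · exact Or.inr (Or.inr (Or.inl (Corner.ext this h)))
      · exact Or.inr (Or.inr (Or.inr (Corner.ext this h)))
  · rintro (rfl | rfl | rfl | rfl)
    exacts [⟨⟨t, rfl⟩, Sym2.mem_mk_left _ _⟩, ⟨⟨t, rfl⟩, Sym2.mem_mk_right _ _⟩,
      ⟨across_hasEdge hf t, Sym2.mem_mk_left _ _⟩, ⟨across_hasEdge hf t, Sym2.mem_mk_right _ _⟩]

theorem proj_ne_proj_of_cell_ne {x y : M.Corner} (h : x.cell ≠ y.cell) : c.proj x ≠ c.proj y :=
  fun h' => h (cell_eq_of_proj_eq h')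

theorem linked_acrossLeft (t : ZMod f.n) : Linked (copy hf t) (acrossLeft hf t) :=
  Or.inr ⟨rfl, (across_ne hf t).symm, f.edge t, Sym2.mem_mk_left _ _, ⟨t, rfl⟩,
    across_hasEdge hf t⟩

theorem linked_acrossRight (t : ZMod f.n) : Linked (copy hf (t + 1)) (acrossRight hf t) :=
  Or.inr ⟨rfl, (across_ne hf t).symm, f.edge t, Sym2.mem_mk_right _ _, ⟨t, rfl⟩,
    across_hasEdge hf t⟩

theorem linked_copy_succ (t : ZMod f.n) : Linked (copy hf t) (copy hf (t + 1)) :=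
  Or.inl ⟨rfl, t, rfl⟩

/-- The two corners in `f` are already one vertex, distinct from those across; the image is a pair
exactly when the latter merge. -/
theorem fourGonCollapsesToEdge_iff {t : ZMod f.n} (ht : t ∈ c.collapsed f) :
    c.FourGonCollapsesToEdge (f.edge t) ↔
      c.proj (acrossLeft hf t) = c.proj (acrossRight hf t) := by
  have hL : c.proj (copy hf t) ≠ c.proj (acrossLeft hf t) :=
    proj_ne_proj_of_cell_ne (across_ne hf t).symm
  have hR : c.proj (copy hf t) ≠ c.proj (acrossRight hf t) :=
    proj_ne_proj_of_cell_ne (across_ne hf t).symm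
  rw [FourGonCollapsesToEdge, fourGonVertices_eq hf t]
  simp only [image_insert_eq, image_singleton, proj_copy_succ hf ht]
  constructor
  · rintro ⟨a, b, -, h⟩
    have h₁ : c.proj (copy hf t) ∈ ({a, b} : Set c.Vertex) := h ▸ by simp
    have h₂ : c.proj (acrossLeft hf t) ∈ ({a, b} : Set c.Vertex) := h ▸ by simp
    have h₃ : c.proj (acrossRight hf t) ∈ ({a, b} : Set c.Vertex) := h ▸ by simp
    simp only [mem_insert_iff, mem_singleton_iff] at h₁ h₂ h₃
    grind
  · intro h
    refine ⟨_, _, (c.adj_iff).2 ⟨hL, _, _, rfl, rfl, (linked_acrossLeft hf t).mem_facets hf⟩, ?_⟩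
    rw [← h]
    simp

/-- The neighbors of a vertex created by collapsing a run of edges of a polygon. -/
theorem neighborSet_eq {i : ZMod f.n} {k : ℕ} (hk : k + 2 < f.n)
    (hcol : ∀ j < k, i + (j : ZMod f.n) ∈ c.collapsed f) (h₁ : i - 1 ∉ c.collapsed f)
    (h₂ : i + (k : ZMod f.n) ∉ c.collapsed f) :
    c.skeleton.neighborSet (c.proj (copy hf i)) =
      {c.proj (copy hf (i - 1)), c.proj (copy hf (i + (k + 1 : ℕ)))} ∪
      ((fun j : ℕ => c.proj (acrossRight hf (i - 1 + (j : ZMod f.n)))) '' Iic k ∪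
        (fun j : ℕ => c.proj (acrossLeft hf (i + (j : ZMod f.n)))) '' Iic k) := by
  have hsimple := (M.isPolygon f hf).1
  have hsat := saturated_arc h₁ h₂
  have h0 : i ∈ {t | ∃ j ≤ k, t = i + (j : ZMod f.n)} := ⟨0, by omega, by simp⟩
  have harc := fun {j} => proj_copy_arc hf hcol (j := j)
  have hprev : ∀ j : ℕ, i - 1 + (j : ZMod f.n) + 1 = i + (j : ZMod f.n) := fun j => by ring
  ext w
  rw [SimpleGraph.mem_neighborSet, adj_iff]
  constructor
  · rintro ⟨hne, x, y, hx, rfl, hxy⟩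
    obtain ⟨_, ⟨j, hj, rfl⟩, rfl⟩ := hsat.exists_of_proj_eq hf h0 hx
    rcases linked_of_mem_facets hxy with ⟨hcell, he⟩ | ⟨hpt, hcell, e, hxe, he, hye⟩
    · left
      obtain ⟨t, ht⟩ : f.HasEdge s(f.vert (i + (j : ZMod f.n)), y.pt) := he
      rcases Sym2.eq_iff.1 ht with ⟨h, hy⟩ | ⟨hy, h⟩
      · obtain rfl : t = i + (j : ZMod f.n) := hsimple h
        obtain rfl : copy hf (i + (j : ZMod f.n) + 1) = y := Corner.ext hcell hy
        -- Inside the run the edge is collapsed and yields a loop; only at `j = k` does it leave the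
        -- class.
        rcases hj.eq_or_lt with rfl | hj
        · right; push_cast; rw [add_assoc]; rfl
        · exact (hne (by rw [proj_copy_succ hf (hcol j hj), harc hj.le])).elim
      · obtain rfl : t = i + (j : ZMod f.n) - 1 := by
          rw [← (hsimple h : t + 1 = i + (j : ZMod f.n))]; ring
        obtain rfl : copy hf (i + (j : ZMod f.n) - 1) = y := Corner.ext hcell hy
        rcases j with - | j
        · left; simp
        · refine (hne ?_).elim
          rw [show i + ((j + 1 : ℕ) : ZMod f.n) - 1 = i + (j : ZMod f.n) by push_cast; ring,
            harc (by omega)]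
    · right
      obtain ⟨t, rfl⟩ : f.HasEdge e := he
      have hcy := eq_across hf y.mem (Ne.symm hcell) hye
      rcases (PolyCell.vert_mem_edge_iff hsimple).1 hxe with rfl | h
      · exact Or.inr ⟨j, hj, congrArg c.proj (Corner.ext hcy.symm hpt)⟩
      · refine Or.inl ⟨j, hj, congrArg c.proj (Corner.ext ?_ ?_)⟩
        · obtain rfl : t = i - 1 + (j : ZMod f.n) := by
            rw [← add_left_inj (1 : ZMod f.n), ← h]; ring
          exact hcy.symm
        · exact (congrArg f.vert (hprev j)).trans hpt
  · have hmk : ∀ {j : ℕ} {y : M.Corner}, j ≤ k → Linked (copy hf (i + (j : ZMod f.n))) y →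
        c.proj (copy hf i) ≠ c.proj y → c.proj (copy hf i) ≠ c.proj y ∧
          ∃ x z, c.proj x = c.proj (copy hf i) ∧ c.proj z = c.proj y ∧ s(x, z) ∈ M.facets :=
      fun hj hl hne => ⟨hne, _, _, harc hj, rfl, hl.mem_facets hf⟩
    rintro ((rfl | rfl) | ⟨j, hj, rfl⟩ | ⟨j, hj, rfl⟩)
    · refine hmk (j := 0) (by omega) ?_ (Ne.symm (hsat.proj_ne hf ?_ h0))
      · have := (linked_copy_succ hf (i - 1)).symm
        rw [sub_add_cancel] at this
        simpa using this
      · rintro ⟨j, hj, h⟩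
        have : ((j + 1 : ℕ) : ZMod f.n) = ((0 : ℕ) : ZMod f.n) := by
          push_cast; linear_combination -h
        have := ZMod.natCast_inj_of_lt (by omega) (by omega) this
        omega
    · refine hmk (j := k) le_rfl ?_ (Ne.symm (hsat.proj_ne hf ?_ h0))
      · have := linked_copy_succ hf (i + (k : ZMod f.n))
        push_cast
        rwa [add_assoc] at this
      · rintro ⟨j, hj, h⟩
        have := ZMod.natCast_inj_of_lt (by omega) (by omega) (add_left_cancel h)
        omega
    · refine hmk hj ?_ (proj_ne_proj_of_cell_ne (across_ne hf _).symm)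
      have := linked_acrossRight hf (i - 1 + (j : ZMod f.n))
      rwa [hprev] at this
    · exact hmk hj (linked_acrossLeft hf _) (proj_ne_proj_of_cell_ne (across_ne hf _).symm)

/-- The vertices from `i + k + 1` to `i + l` form an arc between the kept edges `i + k` and `i + l`;
it is saturated and misses `i - 1`. -/
theorem proj_copy_pred_ne {i : ZMod f.n} {k l : ℕ} (hkl : k < l) (hl : l + 1 < f.n)
    (h₂ : i + (k : ZMod f.n) ∉ c.collapsed f) (h₃ : i + (l : ZMod f.n) ∉ c.collapsed f) :
    c.proj (copy hf (i - 1)) ≠ c.proj (copy hf (i + (k + 1 : ℕ))) := by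
  obtain ⟨d, rfl⟩ := Nat.exists_eq_add_of_lt hkl
  have hsat : c.Saturated f {t | ∃ j ≤ d, t = i + (k + 1 : ℕ) + (j : ZMod f.n)} := by
    refine saturated_arc ?_ ?_
    · rwa [show i + ((k + 1 : ℕ) : ZMod f.n) - 1 = i + (k : ZMod f.n) by push_cast; ring]
    · rwa [show i + ((k + 1 : ℕ) : ZMod f.n) + (d : ZMod f.n) = i + ((k + d + 1 : ℕ) : ZMod f.n) by
        push_cast; ring]
  refine hsat.proj_ne hf ?_ ⟨0, by omega, by simp⟩
  rintro ⟨j, hj, h⟩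
  have : ((k + 1 + j + 1 : ℕ) : ZMod f.n) = ((0 : ℕ) : ZMod f.n) := by
    push_cast at h ⊢; linear_combination -h
  have := ZMod.natCast_inj_of_lt (by omega) (by omega) this
  omega

/-- The degree of a vertex created by collapsing a run of edges of a polygon. -/
theorem degree_add_ncard {i : ZMod f.n} {k : ℕ}
    (hcol : ∀ j < k, i + (j : ZMod f.n) ∈ c.collapsed f) (h₁ : i - 1 ∉ c.collapsed f)
    (h₂ : i + (k : ZMod f.n) ∉ c.collapsed f) :
    c.degree (c.proj (copy hf i)) + {e ∈ run f i k | c.FourGonCollapsesToEdge e}.ncard =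
      2 * k + 4 := by
  obtain ⟨l, hkl, hl, hl'⟩ := exists_kept hf hcol
  have hcast : ∀ {a b : ℕ}, a ≤ k + 1 → b ≤ k + 1 → i + (a : ZMod f.n) = i + (b : ZMod f.n) →
      a = b := fun ha hb h =>
    ZMod.natCast_inj_of_lt (by omega) (by omega) (add_left_cancel h)
  rw [degree, neighborSet_eq hf (by omega) hcol h₁ h₂]
  set R : ℕ → c.Vertex := fun j => c.proj (acrossRight hf (i - 1 + (j : ZMod f.n))) with hR
  set L : ℕ → c.Vertex := fun j => c.proj (acrossLeft hf (i + (j : ZMod f.n))) with hL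
  have hRinj : InjOn R (Iic k) := fun a ha b hb h => by
    have := proj_acrossRight_injective hf h
    have ha : a ≤ k := ha
    have hb : b ≤ k := hb
    exact hcast (by omega) (by omega) (by linear_combination this)
  have hLinj : InjOn L (Iic k) := fun a ha b hb h => by
    have ha : a ≤ k := ha
    have hb : b ≤ k := hb
    exact hcast (by omega) (by omega) (proj_acrossLeft_injective hf h)
  have hsucc : ∀ j : ℕ, R (j + 1) = c.proj (acrossRight hf (i + (j : ZMod f.n))) := fun j => by
    simp only [hR]
    congr 2
    push_cast; ring
  set D : Set ℕ := {j | j < k ∧ L j = R (j + 1)} with hD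
  -- `L b` and `R (b + 1)` belong to the same edge `i + b`. The edges `i - 1` and `i + k` contribute
  -- only `R 0` and `L k`, so they give no coincidence.
  have hinter : R '' Iic k ∩ L '' Iic k = L '' D := by
    ext w
    constructor
    · rintro ⟨⟨a, ha, rfl⟩, ⟨b, hb, hab⟩⟩
      have ha : a ≤ k := ha
      have hb : b ≤ k := hb
      have h := eq_of_proj_acrossLeft_eq hf hab
      have : a = b + 1 := hcast (by omega) (by omega) (by push_cast; linear_combination -h)
      subst this
      exact ⟨b, ⟨by omega, hab⟩, hab⟩
    · rintro ⟨j, ⟨hj, h⟩, rfl⟩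
      exact ⟨⟨j + 1, hj, h.symm⟩, ⟨j, hj.le, rfl⟩⟩
  have hrun : {e ∈ run f i k | c.FourGonCollapsesToEdge e} =
      (fun j : ℕ => f.edge (i + (j : ZMod f.n))) '' D := by
    ext e
    constructor
    · rintro ⟨⟨j, hj, rfl⟩, h⟩
      exact ⟨j, ⟨hj, by rw [hsucc]; exact (fourGonCollapsesToEdge_iff hf (hcol j hj)).1 h⟩, rfl⟩
    · rintro ⟨j, ⟨hj, h⟩, rfl⟩
      exact ⟨⟨j, hj, rfl⟩, (fourGonCollapsesToEdge_iff hf (hcol j hj)).2 (by rw [← hsucc]; exact h)⟩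
  have hDk : D ⊆ Iic k := fun j hj => hj.1.le
  have hDcard : (L '' D).ncard = D.ncard := (hLinj.mono hDk).ncard_image
  have hrcard : {e ∈ run f i k | c.FourGonCollapsesToEdge e}.ncard = D.ncard := by
    rw [hrun]
    refine InjOn.ncard_image fun a ha b hb h => ?_
    have ha : a ≤ k := hDk ha
    have hb : b ≤ k := hDk hb
    exact hcast (by omega) (by omega) (f.edge_injective h)
  have hIic : (Iic k : Set ℕ).ncard = k + 1 := by
    rw [ncard_eq_toFinset_card']; simp
  have hunion := ncard_union_add_ncard_inter (R '' Iic k) (L '' Iic k)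
    ((finite_Iic k).image _) ((finite_Iic k).image _)
  rw [hinter, hDcard, hRinj.ncard_image, hLinj.ncard_image, hIic] at hunion
  have hdisj : Disjoint ({c.proj (copy hf (i - 1)), c.proj (copy hf (i + (k + 1 : ℕ)))} :
      Set c.Vertex) (R '' Iic k ∪ L '' Iic k) := by
    rw [disjoint_left]
    rintro _ (rfl | rfl) (⟨j, -, h⟩ | ⟨j, -, h⟩) <;>
      exact across_ne hf _ (cell_eq_of_proj_eq h)
  rw [ncard_union_eq hdisj (toFinite _) (((finite_Iic k).image _).union ((finite_Iic k).image _)),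
    ncard_pair (proj_copy_pred_ne hf hkl hl h₂ hl'), hrcard]
  omega

end Run

end CombinatorialChange

end InputComplex

end EulerTransformation

theorem mainTheorem7 (M : EulerTransformation.InputComplex) (c : M.CombinatorialChange)
    (f : EulerTransformation.PolyCell) (hf : f ∈ M.K) (i : ZMod f.n) (k : ℕ) (v : c.Vertex)
    (hv : c.CreatedByCollapsing f i k v) :
    ((∀ e ∈ EulerTransformation.InputComplex.CombinatorialChange.run f i k,
        ¬ c.FourGonCollapsesToEdge e) →
      c.degree v = 2 * k + 4) ∧
    (∀ m : ℕ,
      m = {e ∈ EulerTransformation.InputComplex.CombinatorialChange.run f i k |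
        c.FourGonCollapsesToEdge e}.ncard →
      (c.degree v : ℤ) = 2 * k + 4 - m) := by
  obtain ⟨-, hcol, h₁, h₂, x, hx, hxi, rfl⟩ := hv
  obtain rfl : x = EulerTransformation.InputComplex.copy hf i :=
    EulerTransformation.InputComplex.Corner.ext hx hxi
  have h := EulerTransformation.InputComplex.CombinatorialChange.degree_add_ncard hf hcol h₁ h₂
  constructor
  · intro hnone
    have hempty : {e ∈ EulerTransformation.InputComplex.CombinatorialChange.run f i k |
        c.FourGonCollapsesToEdge e} = ∅ :=
      Set.eq_empty_iff_forall_notMem.2 fun e he => hnone e he.1 he.2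
    rw [hempty, Set.ncard_empty] at h
    exact h
  · rintro m rfl
    omega
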